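/- Let $\mathcal A$ be a locally $C^*$-algebra, i.e. a complete Hausdorff complex topological $*$-algebra whose topology is given by an upward filtered family $\{p_\lambda\}_{\lambda\in\Lambda}$ of $C^*$-seminorms, and let $p_\lambda^n$ be the corresponding $C^*$-seminorms on $M_n(\mathcal A)$. Let $\mathcal E=\{\mathcal H_\iota\}_{\iota\in\Upsilon}$ be an upward filtered family of closed subspaces of a complex Hilbert space $\mathcal H$ with dense union $\mathcal D_{\mathcal E}=\bigcup_\iota\mathcal H_\iota$, and let $C^*(\mathcal D_{\mathcal E})$ be the $*$-algebra of all linear operators $T$ on $\mathcal D_{\mathcal E}$ such that, for every $\iota$, $T(\mathcal H_\iota)\subseteq\mathcal H_\iota$, $T|_{\mathcal H_\iota}$ is bounded and $T(\mathcal H_\iota^\perp\cap\mathcal D_{\mathcal E})\subseteq\mathcal H_\iota^\perp\cap\mathcal D_{\mathcal E}$, with the adjoint restricted to $\mathcal D_{\mathcal E}$ as involution and the $C^*$-seminorms $\|T\|_\iota=\|T|_{\mathcal H_\iota}\|$; write $\|\cdot\|_\iota^n$ for the corresponding $C^*$-seminorms on $M_n(C^*(\mathcal D_{\mathcal E}))$.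 For a matrix $a$ over one of these algebras and a seminorm index $\nu$ of that algebra, write $a=_\nu 0$ if the $\nu$-th matrix seminorm of $a$ vanishes, and $a\ge_\nu 0$ if $a=b^*b+c$ with $c=_\nu 0$. Let $\mathcal{CPCC}_{\mathrm{loc}}(\mathcal A,C^*(\mathcal D_{\mathcal E}))$ be the set of linear maps $\varphi:\mathcal A\to C^*(\mathcal D_{\mathcal E})$, with amplifications $\varphi^{(n)}$ to $n\times n$ matrices, that are local completely positive (for every $\iota$ there is $\lambda$ such that for all $n$ and all $a\in M_n(\mathcal A)$: $a\ge_\lambda0$ implies $\varphi^{(n)}(a)\ge_\iota0$, and $a=_\lambda0$ implies $\varphi^{(n)}(a)=_\iota0$) and local completely contractive (for every $\iota$ there is $\lambda$ such that $\|\varphi^{(n)}(a)\|_\iota^n\le p_\lambda^n(a)$ for all $n$ and all $a\in M_n(\mathcal A)$). A map $\varphi$ in this set is pure if every $\psi\in\mathcal{CPCC}_{\mathrm{loc}}(\mathcal A,C^*(\mathcal D_{\mathcal E}))$ with $\varphi-\psi\in\mathcal{CPCC}_{\mathrm{loc}}(\mathcal A,C^*(\mathcal D_{\mathcal E}))$ is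 of the form $\psi=\alpha\varphi$ for some real $\alpha\ge0$. If $\varphi\in\mathcal{CPCC}_{\mathrm{loc}}(\mathcal A,C^*(\mathcal D_{\mathcal E}))$ is pure, then $\varphi$ is a bounded operator valued completely positive map: $\sup_\iota\|\varphi(a)\|_\iota<\infty$ for every $a\in\mathcal A$, and there is a linear map $\Phi:\mathcal A\to B(\mathcal H)$ such that $\Phi(a)|_{\mathcal D_{\mathcal E}}=\varphi(a)$ for all $a\in\mathcal A$ and such that $\Phi$ is completely positive, i.e. for all $n$ and all $b\in M_n(\mathcal A)$ the matrix $\Phi^{(n)}(b^*b)$ is of the form $d^*d$ with $d\in M_n(B(\mathcal H))$. -/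

import Mathlib

open scoped InnerProductSpace

section LocallyCStar

/-- `A`, with its uniform structure, is a locally C⋆-algebra with respect to the family `p`:
a complete Hausdorff complex `⋆`-algebra whose topology is determined by the upward filtered
family `p` of C⋆-seminorms. No unit is required. -/
structure IsLocallyCStarAlgebra {A Λ : Type*} [NonUnitalRing A] [StarRing A] [Module ℂ A]
    [IsScalarTower ℂ A A] [SMulCommClass ℂ A A] [StarModule ℂ A] [UniformSpace A]
    [IsUniformAddGroup A] [CompleteSpace A] [T2Space A] (p : Λ → Seminorm ℂ A) : Prop where
  nonempty : Nonempty Λ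
  directed : Directed (· ≤ ·) p
  topology : WithSeminorms p
  mul_le : ∀ (l : Λ) (a b : A), p l (a * b) ≤ p l a * p l b
  map_star : ∀ (l : Λ) (a : A), p l (star a) = p l a
  map_star_mul_self : ∀ (l : Λ) (a : A), p l (star a * a) = p l a ^ 2

variable {A B Λ Δ : Type*} [NonUnitalRing A] [StarRing A] [Module ℂ A]
  [NonUnitalRing B] [StarRing B] [Module ℂ B]

/-- Positive elements of a `⋆`-algebra: those of the form `b⋆ b`. -/
def IsPositiveElement {R : Type*} [NonUnitalRing R] [StarRing R] (a : R) : Prop :=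
  ∃ b : R, a = star b * b

/-- Bounded elements: `sup_λ p_λ(a) < ∞`. -/
def IsBoundedElement (p : Λ → Seminorm ℂ A) (a : A) : Prop :=
  BddAbove (Set.range fun l => p l a)

/-- The C⋆-seminorm `pⁿ` on `Mₙ(A)` coming from a C⋆-seminorm `p` on `A`: the seminorm of `a` as
an operator on the (pre-)Hilbert module `Aⁿ` with inner product `⟨x, y⟩ = ∑ᵢ xᵢ⋆ yᵢ`. It is
the C⋆-norm of the image of `a` in `Mₙ(A / ker p)`. -/
noncomputable def matrixSeminorm (p : Seminorm ℂ A) {n : ℕ} (a : Matrix (Fin n) (Fin n) A) : ℝ :=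
  sSup {r : ℝ | ∃ x : Fin n → A, p (star x ⬝ᵥ x) ≤ 1 ∧
    r = √(p (star (a.mulVec x) ⬝ᵥ a.mulVec x))}

/-- `a =_λ 0` in `Mₙ(A)`, where `p = p_λ`. -/
def IsMatrixLocalZero (p : Seminorm ℂ A) {n : ℕ} (a : Matrix (Fin n) (Fin n) A) : Prop :=
  matrixSeminorm p a = 0

/-- `a ≥_λ 0` in `Mₙ(A)`, where `p = p_λ`. -/
def IsMatrixLocalPositive (p : Seminorm ℂ A) {n : ℕ} (a : Matrix (Fin n) (Fin n) A) : Prop :=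
  ∃ b c : Matrix (Fin n) (Fin n) A, a = star b * b + c ∧ IsMatrixLocalZero p c

/-- Local completely contractive maps; `a.map φ` is the `n`-amplification of `φ` at `a`. -/
def IsLocalCC (p : Λ → Seminorm ℂ A) (q : Δ → Seminorm ℂ B) (φ : A →ₗ[ℂ] B) : Prop :=
  ∀ d : Δ, ∃ l : Λ, ∀ (n : ℕ) (a : Matrix (Fin n) (Fin n) A),
    matrixSeminorm (q d) (a.map φ) ≤ matrixSeminorm (p l) a

/-- Local completely positive maps. -/
def IsLocalCP (p : Λ → Seminorm ℂ A) (q : Δ → Seminorm ℂ B) (φ : A →ₗ[ℂ] B) : Prop :=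
  ∀ d : Δ, ∃ l : Λ, ∀ (n : ℕ) (a : Matrix (Fin n) (Fin n) A),
    (IsMatrixLocalPositive (p l) a → IsMatrixLocalPositive (q d) (a.map φ)) ∧
    (IsMatrixLocalZero (p l) a → IsMatrixLocalZero (q d) (a.map φ))

/-- The class `CPCC_loc`. -/
def IsLocalCPCC (p : Λ → Seminorm ℂ A) (q : Δ → Seminorm ℂ B) (φ : A →ₗ[ℂ] B) : Prop :=
  IsLocalCP p q φ ∧ IsLocalCC p q φ

/-- `ψ` is dominated by `φ` (for `φ`, `ψ` in `CPCC_loc`). -/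
def IsDominatedBy (p : Λ → Seminorm ℂ A) (q : Δ → Seminorm ℂ B) (ψ φ : A →ₗ[ℂ] B) : Prop :=
  IsLocalCPCC p q (φ - ψ)

/-- `φ` is pure (for `φ` in `CPCC_loc`): the only maps in `CPCC_loc` dominated by `φ` are
the nonnegative multiples of `φ`. (The zero map is dominated by every `φ`, so `α = 0` has to be
allowed.) -/
def IsPureCPCC (p : Λ → Seminorm ℂ A) (q : Δ → Seminorm ℂ B) (φ : A →ₗ[ℂ] B) : Prop :=
  ∀ ψ : A →ₗ[ℂ] B, IsLocalCPCC p q ψ → IsDominatedBy p q ψ φ →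
    ∃ α : ℝ, 0 ≤ α ∧ ψ = (α : ℂ) • φ

/-- Completely positive maps between `⋆`-algebras. -/
def IsCompletelyPositive (φ : A →ₗ[ℂ] B) : Prop :=
  ∀ (n : ℕ) (a : Matrix (Fin n) (Fin n) A), IsPositiveElement a → IsPositiveElement (a.map φ)

end LocallyCStar

/-- A quantized domain in the Hilbert space `H`: an upward filtered family of closed subspaces
whose union is dense. -/
structure QuantizedDomain (Υ H : Type*) [NormedAddCommGroup H] [InnerProductSpace ℂ H] where
  subspace : Υ → Submodule ℂ H
  nonempty : Nonempty Υ
  directed : Directed (· ≤ ·) subspace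
  isClosed : ∀ i, IsClosed (subspace i : Set H)
  dense : Dense (⋃ i, (subspace i : Set H))

namespace QuantizedDomain

section

variable {Υ H : Type*} [NormedAddCommGroup H] [InnerProductSpace ℂ H] (E : QuantizedDomain Υ H)

/-- The union space `D_E`; the supremum of the directed family is its union, see `mem_domain`. -/
def domain : Submodule ℂ H := ⨆ i, E.subspace i

theorem mem_domain {x : H} : x ∈ E.domain ↔ ∃ i, x ∈ E.subspace i := by
  have := E.nonempty
  exact Submodule.mem_iSup_of_directed _ E.directed

theorem subspace_le_domain (i : Υ) : E.subspace i ≤ E.domain := le_iSup E.subspace i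

/-- The algebra `C⋆(D_E)`: the linear operators `T` on `D_E` with `T(H_ι) ⊆ H_ι`,
`T|_{H_ι}` bounded, and `T(H_ι^⊥ ∩ D_E) ⊆ H_ι^⊥ ∩ D_E`, for all `ι`. -/
def cstar : Subalgebra ℂ (Module.End ℂ E.domain) where
  carrier := {T | ∀ i,
    (∀ x : E.domain, (x : H) ∈ E.subspace i → (T x : H) ∈ E.subspace i) ∧
    (∃ C : ℝ, ∀ x : E.domain, (x : H) ∈ E.subspace i → ‖T x‖ ≤ C * ‖x‖) ∧
    (∀ x : E.domain, (x : H) ∈ (E.subspace i)ᗮ → (T x : H) ∈ (E.subspace i)ᗮ)}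
  mul_mem' := by
    intro S T hS hT i
    obtain ⟨hS1, ⟨C, hC⟩, hS3⟩ := hS i
    obtain ⟨hT1, ⟨D, hD⟩, hT3⟩ := hT i
    refine ⟨fun x hx => hS1 _ (hT1 x hx), ⟨|C| * D, fun x hx => ?_⟩,
      fun x hx => hS3 _ (hT3 x hx)⟩
    calc ‖S (T x)‖ ≤ C * ‖T x‖ := hC _ (hT1 x hx)
      _ ≤ |C| * ‖T x‖ := by gcongr; exact le_abs_self C
      _ ≤ |C| * (D * ‖x‖) := by gcongr; exact hD x hx
      _ = |C| * D * ‖x‖ := by ring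
  add_mem' := by
    intro S T hS hT i
    obtain ⟨hS1, ⟨C, hC⟩, hS3⟩ := hS i
    obtain ⟨hT1, ⟨D, hD⟩, hT3⟩ := hT i
    refine ⟨fun x hx => add_mem (hS1 x hx) (hT1 x hx), ⟨C + D, fun x hx => ?_⟩,
      fun x hx => add_mem (hS3 x hx) (hT3 x hx)⟩
    calc ‖S x + T x‖ ≤ ‖S x‖ + ‖T x‖ := norm_add_le _ _
      _ ≤ C * ‖x‖ + D * ‖x‖ := add_le_add (hC x hx) (hD x hx)
      _ = (C + D) * ‖x‖ := by ring
  algebraMap_mem' := by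
    intro c i
    refine ⟨fun x hx => ?_, ⟨‖c‖, fun x _ => ?_⟩, fun x hx => ?_⟩
    · exact (E.subspace i).smul_mem c hx
    · rw [Module.algebraMap_end_apply, norm_smul]
    · exact ((E.subspace i)ᗮ).smul_mem c hx

/-- The restriction `T|_{H_ι}` of `T ∈ C⋆(D_E)`, as a bounded operator on `H_ι`. -/
noncomputable def restrict (i : Υ) (T : E.cstar) : E.subspace i →L[ℂ] E.subspace i :=
  LinearMap.mkContinuousOfExistsBound
    { toFun := fun x =>
        ⟨T.1 ⟨x, E.subspace_le_domain i x.2⟩, (T.2 i).1 ⟨x, E.subspace_le_domain i x.2⟩ x.2⟩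
      map_add' := fun x y => Subtype.ext <| congrArg (Subtype.val : E.domain → H) <|
        T.1.map_add ⟨x, E.subspace_le_domain i x.2⟩ ⟨y, E.subspace_le_domain i y.2⟩
      map_smul' := fun c x => Subtype.ext <| congrArg (Subtype.val : E.domain → H) <|
        T.1.map_smul c ⟨x, E.subspace_le_domain i x.2⟩ }
    (by
      obtain ⟨C, hC⟩ := (T.2 i).2.1
      exact ⟨C, fun x => hC ⟨x, E.subspace_le_domain i x.2⟩ x.2⟩)

theorem coe_restrict_apply (i : Υ) (T : E.cstar) (x : E.subspace i) :
    (E.restrict i T x : H) = T.1 ⟨x, E.subspace_le_domain i x.2⟩ := rfl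

/-- The C⋆-seminorm `‖T‖_ι = ‖T|_{H_ι}‖` on `C⋆(D_E)`. -/
noncomputable def seminorm (i : Υ) : Seminorm ℂ E.cstar :=
  Seminorm.of (fun T => ‖E.restrict i T‖)
    (fun S T => norm_add_le (E.restrict i S) (E.restrict i T))
    (fun c T => map_smul_eq_mul (normSeminorm ℂ (E.subspace i →L[ℂ] E.subspace i)) c
      (E.restrict i T))

theorem seminorm_apply (i : Υ) (T : E.cstar) : E.seminorm i T = ‖E.restrict i T‖ := rfl

end

section Adjoint

variable {Υ H : Type*} [NormedAddCommGroup H] [InnerProductSpace ℂ H] [CompleteSpace H]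
  (E : QuantizedDomain Υ H)

/-- Every `T ∈ C⋆(D_E)` has a formal adjoint in `C⋆(D_E)`. -/
theorem exists_adjoint (T : E.cstar) :
    ∃ S : E.cstar, ∀ x y : E.domain, ⟪(T.1 x : H), (y : H)⟫_ℂ = ⟪(x : H), (S.1 y : H)⟫_ℂ := by
  have hcomp : ∀ i, CompleteSpace (E.subspace i) := fun i =>
    (E.isClosed i).completeSpace_coe
  -- the pointwise adjoint on each closed subspace
  have key : ∀ (i : Υ) (y : E.subspace i) (x : E.domain),
      ⟪(T.1 x : H), (y : H)⟫_ℂ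
        = ⟪(x : H), (ContinuousLinearMap.adjoint (E.restrict i T) y : H)⟫_ℂ := by
    intro i y x
    set u : E.subspace i := (E.subspace i).orthogonalProjectionOnto (x : H) with hu
    have hud : (u : H) ∈ E.domain := E.subspace_le_domain i u.2
    have hv : (x : H) - u ∈ (E.subspace i)ᗮ :=
      Submodule.sub_starProjection_mem_orthogonal (K := E.subspace i) (x : H)
    set v : E.domain := x - ⟨u, hud⟩ with hvdef
    have hvo : (v : H) ∈ (E.subspace i)ᗮ := hv
    have hxuv : x = ⟨u, hud⟩ + v := by rw [hvdef]; abel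
    have h1 : ⟪(T.1 v : H), (y : H)⟫_ℂ = 0 :=
      (Submodule.mem_orthogonal' _ _).1 ((T.2 i).2.2 v hvo) y y.2
    have h2 : ⟪(v : H), (ContinuousLinearMap.adjoint (E.restrict i T) y : H)⟫_ℂ = 0 :=
      (Submodule.mem_orthogonal' _ _).1 hvo _ (Submodule.coe_mem _)
    have h3 : ⟪(T.1 ⟨u, hud⟩ : H), (y : H)⟫_ℂ
        = ⟪(u : H), (ContinuousLinearMap.adjoint (E.restrict i T) y : H)⟫_ℂ :=
      (ContinuousLinearMap.adjoint_inner_right (E.restrict i T) u y).symm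
    rw [hxuv, map_add, Submodule.coe_add, Submodule.coe_add, inner_add_left, inner_add_left,
      h1, h2, add_zero, add_zero, h3]
  have ex : ∀ y : E.domain, ∃ z : E.domain, ∀ x : E.domain,
      ⟪(T.1 x : H), (y : H)⟫_ℂ = ⟪(x : H), (z : H)⟫_ℂ := by
    intro y
    obtain ⟨i, hi⟩ := E.mem_domain.1 y.2
    exact ⟨⟨_, E.subspace_le_domain i (ContinuousLinearMap.adjoint (E.restrict i T) ⟨y, hi⟩).2⟩,
      fun x => key i ⟨y, hi⟩ x⟩
  have uniq : ∀ z w : E.domain, (∀ x : E.domain, ⟪(x : H), (z : H)⟫_ℂ = ⟪(x : H), (w : H)⟫_ℂ) →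
      z = w := fun z w h => ext_inner_left ℂ h
  choose f hf using ex
  have hfi : ∀ (i : Υ) (y : E.domain) (hy : (y : H) ∈ E.subspace i),
      (f y : H) = ContinuousLinearMap.adjoint (E.restrict i T) ⟨y, hy⟩ := by
    intro i y hy
    have := uniq (f y) ⟨_, E.subspace_le_domain i
      (ContinuousLinearMap.adjoint (E.restrict i T) ⟨y, hy⟩).2⟩
      (fun x => by rw [← hf y x]; exact key i ⟨y, hy⟩ x)
    exact congrArg Subtype.val this
  let S : Module.End ℂ E.domain :=
    { toFun := f
      map_add' := fun y z => uniq _ _ fun x => by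
        rw [← hf, Submodule.coe_add, Submodule.coe_add, inner_add_right, inner_add_right,
          hf y, hf z]
      map_smul' := fun c y => uniq _ _ fun x => by
        rw [← hf, RingHom.id_apply, Submodule.coe_smul, Submodule.coe_smul, inner_smul_right,
          inner_smul_right, hf y] }
  refine ⟨⟨S, fun i => ⟨fun y hy => ?_, ⟨‖ContinuousLinearMap.adjoint (E.restrict i T)‖,
    fun y hy => ?_⟩, fun y hy => ?_⟩⟩, fun x y => hf y x⟩
  · change (f y : H) ∈ _
    rw [hfi i y hy]
    exact Submodule.coe_mem _
  · change ‖(f y : H)‖ ≤ _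
    rw [hfi i y hy]
    exact (ContinuousLinearMap.adjoint (E.restrict i T)).le_opNorm ⟨y, hy⟩
  · change (f y : H) ∈ _
    rw [Submodule.mem_orthogonal]
    intro u hu
    have h := hf y ⟨u, E.subspace_le_domain i hu⟩
    rw [← h]
    exact (Submodule.mem_orthogonal _ _).1 hy _ ((T.2 i).1 ⟨u, E.subspace_le_domain i hu⟩ hu)

/-- The involution of `C⋆(D_E)`: `T⋆` is the restriction to `D_E` of the Hilbert space adjoint of
`T`, that is, the operator on `D_E` with `⟪T x, y⟫ = ⟪x, T⋆ y⟫`. -/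
noncomputable instance : Star E.cstar := ⟨fun T => (E.exists_adjoint T).choose⟩

theorem inner_star_right (T : E.cstar) (x y : E.domain) :
    ⟪(x : H), ((star T).1 y : H)⟫_ℂ = ⟪(T.1 x : H), (y : H)⟫_ℂ :=
  ((E.exists_adjoint T).choose_spec x y).symm

theorem eq_star_of_inner {S T : E.cstar}
    (h : ∀ x y : E.domain, ⟪(x : H), (S.1 y : H)⟫_ℂ = ⟪(T.1 x : H), (y : H)⟫_ℂ) :
    S = star T := by
  refine Subtype.ext (LinearMap.ext fun y => ?_)
  exact ext_inner_left ℂ fun x => (h x y).trans (E.inner_star_right T x y).symm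

noncomputable instance : StarRing E.cstar where
  star_involutive T := (E.eq_star_of_inner fun x y => by
    rw [← inner_conj_symm, ← E.inner_star_right, inner_conj_symm]).symm
  star_mul S T := (E.eq_star_of_inner fun x y => by
    change ⟪(x : H), ((star T).1 ((star S).1 y) : H)⟫_ℂ = ⟪(S.1 (T.1 x) : H), (y : H)⟫_ℂ
    rw [E.inner_star_right, E.inner_star_right]).symm
  star_add S T := (E.eq_star_of_inner fun x y => by
    change ⟪(x : H), ((star S).1 y : H) + ((star T).1 y : H)⟫_ℂ
      = ⟪(S.1 x : H) + (T.1 x : H), (y : H)⟫_ℂ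
    rw [inner_add_right, inner_add_left, E.inner_star_right, E.inner_star_right]).symm

end Adjoint

end QuantizedDomain

/-! Purity forces φ to live on one central summand of `C⋆(D_E)`, and the summands used here consist
of bounded operators. The projection `P_ι` onto `H_ι` commutes with every `T ∈ C⋆(D_E)`, but it need
not belong to `C⋆(D_E)`, because it may fail to leave another `H_κ` invariant. So `H_ι` is enlarged
to its saturation: the vectors `y` of `D_E` with `‖T y‖ ≤ C ‖T‖_ι` for all `T` and some `C`. This
space is invariant under `C⋆(D_E)` and under all `P_κ`, so its projection `z` (`centralSupport`) is
a central projection of `C⋆(D_E)`. By the C⋆-identity `C` can be taken to be `‖y‖`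
(`norm_apply_le_of_mem_saturation`), so `‖T z x‖ ≤ ‖T‖_ι ‖x‖` on all of `D_E`.

Multiplication by a central projection preserves `CPCC_loc` (`IsLocalCPCC.mulLeft_comp`). Hence `zφ`
and `φ - zφ = (1 - z)φ` are both in the class, and purity gives `zφ = αφ`. If `φ(a)x ≠ 0` for some
`x ∈ H_ι`, then `z x = x` forces `α = 1` (`exists_centralSupport_mul_eq`). Thus `φ(a) = φ(a)z` is
bounded by `‖φ(a)‖_ι`.

Density of `D_E` then yields the extension Φ. Finitely many vectors of `D_E` lie in a common `H_ι`,
so local positivity makes the quadratic form of `Φⁿ(b⋆b)` nonnegative on a dense set, hence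
everywhere; a positive operator on `Hⁿ` factors as `d⋆d`. -/

/-- An orthogonal projection commutes with every map `f` such that both `f` and a formal adjoint
of `f` leave the subspace invariant. -/
theorem Submodule.starProjection_comm_of_invariant {D : Type*} [NormedAddCommGroup D]
    [InnerProductSpace ℂ D] (L : Submodule ℂ D) [L.HasOrthogonalProjection] (f g : D →ₗ[ℂ] D)
    (hfg : ∀ x y, ⟪x, g y⟫_ℂ = ⟪f x, y⟫_ℂ) (hf : ∀ x ∈ L, f x ∈ L) (hg : ∀ x ∈ L, g x ∈ L)
    (x : D) : L.starProjection (f x) = f (L.starProjection x) := by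
  refine (Submodule.eq_starProjection_of_mem_orthogonal
    (hf _ (Submodule.starProjection_apply_mem L x)) ?_)
  rw [← map_sub, Submodule.mem_orthogonal']
  intro y hy
  rw [← hfg]
  exact (Submodule.mem_orthogonal' _ _).1
    (Submodule.sub_starProjection_mem_orthogonal (K := L) x) _ (hg y hy)

/-! ### Saturations of the subspaces and their central projections. -/

namespace QuantizedDomain

section

variable {Υ H : Type*} [NormedAddCommGroup H] [InnerProductSpace ℂ H] (E : QuantizedDomain Υ H)

theorem norm_apply_le (i : Υ) (T : E.cstar) (x : E.domain) (hx : (x : H) ∈ E.subspace i) :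
    ‖T.1 x‖ ≤ E.seminorm i T * ‖x‖ :=
  (E.restrict i T).le_opNorm ⟨x, hx⟩

theorem seminorm_le (i : Υ) (T : E.cstar) {C : ℝ} (hC : 0 ≤ C)
    (h : ∀ x : E.domain, (x : H) ∈ E.subspace i → ‖T.1 x‖ ≤ C * ‖x‖) : E.seminorm i T ≤ C :=
  ContinuousLinearMap.opNorm_le_bound _ hC fun x => h ⟨x, E.subspace_le_domain i x.2⟩ x.2

theorem seminorm_mul_le (i : Υ) (S T : E.cstar) :
    E.seminorm i (S * T) ≤ E.seminorm i S * E.seminorm i T := by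
  refine E.seminorm_le i _ (by positivity) fun x hx => ?_
  calc ‖S.1 (T.1 x)‖ ≤ E.seminorm i S * ‖T.1 x‖ := E.norm_apply_le i S _ ((T.2 i).1 x hx)
    _ ≤ E.seminorm i S * (E.seminorm i T * ‖x‖) := by gcongr; exact E.norm_apply_le i T x hx
    _ = _ := by ring

theorem seminorm_one_le (i : Υ) : E.seminorm i (1 : E.cstar) ≤ 1 :=
  E.seminorm_le i _ zero_le_one fun x _ => by simp

/-- The subspace `H_ι`, as a subspace of `D_E`. -/
def level (i : Υ) : Submodule ℂ E.domain := (E.subspace i).comap E.domain.subtype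

theorem mem_level {i : Υ} {x : E.domain} : x ∈ E.level i ↔ (x : H) ∈ E.subspace i := Iff.rfl

theorem mem_level_orthogonal {i : Υ} {x : E.domain} :
    x ∈ (E.level i)ᗮ ↔ (x : H) ∈ (E.subspace i)ᗮ := by
  rw [Submodule.mem_orthogonal, Submodule.mem_orthogonal]
  exact ⟨fun h u hu => h ⟨u, E.subspace_le_domain i hu⟩ hu, fun h u hu => h u hu⟩

/-- The vectors of `D_E` at which all of `C⋆(D_E)` is bounded in terms of `‖·‖_ι`. -/
def saturation (i : Υ) : Submodule ℂ E.domain where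
  carrier := {y | ∃ C : ℝ, ∀ T : E.cstar, ‖T.1 y‖ ≤ C * E.seminorm i T}
  zero_mem' := ⟨0, fun T => by simp⟩
  add_mem' := by
    rintro x y ⟨C, hC⟩ ⟨D, hD⟩
    refine ⟨C + D, fun T => ?_⟩
    rw [map_add, add_mul]
    exact (norm_add_le _ _).trans (add_le_add (hC T) (hD T))
  smul_mem' := by
    rintro c x ⟨C, hC⟩
    refine ⟨‖c‖ * C, fun T => ?_⟩
    rw [map_smul, norm_smul, mul_assoc]
    gcongr
    exact hC T

theorem level_le_saturation (i : Υ) : E.level i ≤ E.saturation i := fun x hx =>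
  ⟨‖x‖, fun T => by rw [mul_comm]; exact E.norm_apply_le i T x hx⟩

theorem apply_mem_saturation {i : Υ} (S : E.cstar) {x : E.domain} (hx : x ∈ E.saturation i) :
    S.1 x ∈ E.saturation i := by
  obtain ⟨C, hC⟩ := hx
  refine ⟨|C| * E.seminorm i S, fun T => ?_⟩
  calc ‖T.1 (S.1 x)‖ ≤ C * E.seminorm i (T * S) := hC (T * S)
    _ ≤ |C| * E.seminorm i (T * S) := by gcongr; exact le_abs_self C
    _ ≤ |C| * (E.seminorm i T * E.seminorm i S) := by gcongr; exact E.seminorm_mul_le i T S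
    _ = _ := by ring

end

section Adjoint

variable {Υ H : Type*} [NormedAddCommGroup H] [InnerProductSpace ℂ H] [CompleteSpace H]
  (E : QuantizedDomain Υ H)

instance completeSpace_subspace (i : Υ) : CompleteSpace (E.subspace i) :=
  (E.isClosed i).completeSpace_coe

/-- Pointwise form of the C⋆-identity: `‖T x‖² = ⟪x, T⋆T x⟫`, followed by Cauchy–Schwarz. -/
theorem norm_apply_sq_le (T : E.cstar) (x : E.domain) :
    ‖T.1 x‖ ^ 2 ≤ ‖(star T * T).1 x‖ * ‖x‖ := by
  have h : ⟪(x : H), ((star T).1 (T.1 x) : H)⟫_ℂ = ⟪(T.1 x : H), (T.1 x : H)⟫_ℂ :=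
    E.inner_star_right T x (T.1 x)
  have h2 := norm_inner_le_norm (𝕜 := ℂ) (x : H) ((star T).1 (T.1 x) : H)
  rw [h, inner_self_eq_norm_sq_to_K, norm_pow, RCLike.norm_ofReal, abs_norm, mul_comm] at h2
  exact h2

theorem seminorm_star_le (i : Υ) (T : E.cstar) : E.seminorm i (star T) ≤ E.seminorm i T := by
  refine E.seminorm_le i _ (by positivity) fun x hx => ?_
  have h1 := E.norm_apply_sq_le (star T) x
  rw [star_star] at h1
  have h2 : ‖(T * star T).1 x‖ ≤ E.seminorm i T * ‖(star T).1 x‖ :=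
    E.norm_apply_le i T _ (((star T).2 i).1 x hx)
  by_contra! h
  have h3 : 0 ≤ E.seminorm i T * ‖x‖ := by positivity
  have h4 := mul_le_mul_of_nonneg_right h2 (norm_nonneg x)
  nlinarith

theorem seminorm_star (i : Υ) (T : E.cstar) : E.seminorm i (star T) = E.seminorm i T :=
  le_antisymm (E.seminorm_star_le i T) (by simpa using E.seminorm_star_le i (star T))

/-- `D_E` need not be complete, but the projection of `H` onto `H_ι` takes values in `H_ι ⊆ D_E`. -/
instance hasOrthogonalProjection_level (i : Υ) : (E.level i).HasOrthogonalProjection where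
  exists_orthogonal x := by
    refine ⟨⟨(E.subspace i).starProjection (x : H),
      E.subspace_le_domain i (Submodule.starProjection_apply_mem _ _)⟩,
      Submodule.starProjection_apply_mem _ _, ?_⟩
    rw [mem_level_orthogonal]
    exact Submodule.sub_starProjection_mem_orthogonal (K := E.subspace i) (x : H)

theorem level_starProjection_apply (i : Υ) (T : E.cstar) (x : E.domain) :
    (E.level i).starProjection (T.1 x) = T.1 ((E.level i).starProjection x) :=
  Submodule.starProjection_comm_of_invariant _ T.1 (star T).1
    (fun x y => E.inner_star_right T x y) (fun x hx => (T.2 i).1 x hx)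
    (fun x hx => ((star T).2 i).1 x hx) x

/-- The projection onto `H_κ` commutes with every `T` and is contractive, so the same constant `C`
works. This is what lets the saturation, unlike `H_ι`, have its projection in `C⋆(D_E)`. -/
theorem starProjection_level_mem_saturation {i : Υ} (k : Υ) {x : E.domain}
    (hx : x ∈ E.saturation i) : (E.level k).starProjection x ∈ E.saturation i := by
  obtain ⟨C, hC⟩ := hx
  refine ⟨C, fun T => ?_⟩
  rw [← level_starProjection_apply]
  exact (Submodule.norm_starProjection_apply_le _ _).trans (hC T)

/-- On the saturation, `‖T x‖ ≤ ‖T‖_ι ‖x‖`: the best constant `C` at `x` satisfies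
`C² ≤ C ‖x‖` by the C⋆-identity. -/
theorem norm_apply_le_of_mem_saturation {i : Υ} {x : E.domain} (hx : x ∈ E.saturation i)
    (T : E.cstar) : ‖T.1 x‖ ≤ E.seminorm i T * ‖x‖ := by
  set S : Set ℝ := {C | 0 ≤ C ∧ ∀ T : E.cstar, ‖T.1 x‖ ≤ C * E.seminorm i T}
  have hne : S.Nonempty := by
    obtain ⟨C, hC⟩ := hx
    exact ⟨|C|, abs_nonneg C, fun T => (hC T).trans (by gcongr; exact le_abs_self C)⟩
  have hbdd : BddBelow S := ⟨0, fun C hC => hC.1⟩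
  have h0 : 0 ≤ sInf S := le_csInf hne fun C hC => hC.1
  have hmem : ∀ T : E.cstar, ‖T.1 x‖ ≤ sInf S * E.seminorm i T := by
    intro T
    -- The infimum is itself an admissible constant: if `‖T‖_ι = 0`, any admissible constant already
    -- gives `T x = 0`; otherwise divide by `‖T‖_ι`.
    rcases (apply_nonneg (E.seminorm i) T).eq_or_lt with h | h
    · obtain ⟨C, hC⟩ := hne
      have := hC.2 T
      rwa [← h, mul_zero] at this ⊢
    · rw [← div_le_iff₀ h]
      exact le_csInf hne fun C hC => (div_le_iff₀ h).2 (hC.2 T)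
  have hsqrt : √(sInf S * ‖x‖) ∈ S := by
    refine ⟨Real.sqrt_nonneg _, fun T => ?_⟩
    refine (pow_le_pow_iff_left₀ (norm_nonneg _) (by positivity) two_ne_zero).1 ?_
    rw [mul_pow, Real.sq_sqrt (by positivity)]
    calc ‖T.1 x‖ ^ 2 ≤ ‖(star T * T).1 x‖ * ‖x‖ := E.norm_apply_sq_le T x
      _ ≤ (sInf S * E.seminorm i (star T * T)) * ‖x‖ := by gcongr; exact hmem _
      _ ≤ (sInf S * (E.seminorm i T * E.seminorm i T)) * ‖x‖ := by
        gcongr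
        exact (E.seminorm_mul_le i _ _).trans_eq (by rw [seminorm_star])
      _ = _ := by ring
  have hle : sInf S ≤ √(sInf S * ‖x‖) := csInf_le hbdd hsqrt
  have hle' : sInf S ≤ ‖x‖ := by
    by_contra! h
    have hsq := (Real.le_sqrt' ((norm_nonneg x).trans_lt h)).1 hle
    nlinarith [norm_nonneg x]
  calc ‖T.1 x‖ ≤ sInf S * E.seminorm i T := hmem T
    _ ≤ ‖x‖ * E.seminorm i T := by gcongr
    _ = _ := mul_comm _ _

/-- Existence is not automatic in the possibly incomplete `D_E`. For `x ∈ H_κ`, project inside the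
complete space `H_κ` onto its intersection with the saturation. The remainder is orthogonal to the
whole saturation because the latter is stable under the projection onto `H_κ`. -/
instance hasOrthogonalProjection_saturation (i : Υ) :
    (E.saturation i).HasOrthogonalProjection where
  exists_orthogonal x := by
    obtain ⟨k, hk⟩ := E.mem_domain.1 x.2
    let M : Submodule ℂ (E.subspace k) :=
      (E.saturation i).comap (Submodule.inclusion (E.subspace_le_domain k))
    have hM : IsClosed (M : Set (E.subspace k)) := by
      -- Replacing the unspecified constant by `‖y‖` turns membership into a family of closed
      -- conditions.
      have : (M : Set (E.subspace k)) =
          ⋂ T : E.cstar, {y | ‖E.restrict k T y‖ ≤ E.seminorm i T * ‖y‖} := by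
        ext y
        rw [Set.mem_iInter]
        exact ⟨fun hy T => E.norm_apply_le_of_mem_saturation hy T, fun hy =>
          ⟨‖y‖, fun T => (hy T).trans_eq (mul_comm _ _)⟩⟩
      rw [this]
      exact isClosed_iInter fun T => isClosed_le (by fun_prop) (by fun_prop)
    have : CompleteSpace M := hM.completeSpace_coe
    let u : E.subspace k := M.starProjection ⟨x, hk⟩
    have hu : u ∈ M := Submodule.starProjection_apply_mem _ _
    refine ⟨Submodule.inclusion (E.subspace_le_domain k) u, hu, ?_⟩
    rw [Submodule.mem_orthogonal]
    intro y hy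
    have hw : (x - Submodule.inclusion (E.subspace_le_domain k) u) ∈ E.level k :=
      (E.subspace k).sub_mem hk u.2
    set w := x - Submodule.inclusion (E.subspace_le_domain k) u
    -- Since `w` lies in `H_κ`, only the component of `y` in `H_κ` matters.
    have h1 : ⟪y, w⟫_ℂ = ⟪(E.level k).starProjection y, w⟫_ℂ := by
      rw [Submodule.inner_starProjection_left_eq_right,
        Submodule.starProjection_eq_self_iff.2 hw]
    rw [h1]
    have hPy := E.starProjection_level_mem_saturation k hy
    exact (Submodule.mem_orthogonal _ _).1
      (Submodule.sub_starProjection_mem_orthogonal (K := M) ⟨x, hk⟩)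
      ⟨(E.level k).starProjection y, Submodule.starProjection_apply_mem (E.level k) y⟩ hPy

theorem starProjection_saturation_comm (i : Υ) (T : E.cstar) (x : E.domain) :
    (E.saturation i).starProjection (T.1 x) = T.1 ((E.saturation i).starProjection x) :=
  Submodule.starProjection_comm_of_invariant _ T.1 (star T).1
    (fun x y => E.inner_star_right T x y) (fun _ hx => E.apply_mem_saturation T hx)
    (fun _ hx => E.apply_mem_saturation (star T) hx) x

theorem starProjection_saturation_level_comm (i k : Υ) (x : E.domain) :
    (E.saturation i).starProjection ((E.level k).starProjection x)
      = (E.level k).starProjection ((E.saturation i).starProjection x) :=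
  Submodule.starProjection_comm_of_invariant _ (E.level k).starProjection.toLinearMap
    (E.level k).starProjection.toLinearMap
    (fun x y => (Submodule.inner_starProjection_left_eq_right (E.level k) x y).symm)
    (fun _ hx => E.starProjection_level_mem_saturation k hx)
    (fun _ hx => E.starProjection_level_mem_saturation k hx) x

/-- The orthogonal projection onto the saturation of `H_ι`, as an element of `C⋆(D_E)`. -/
noncomputable def centralSupport (i : Υ) : E.cstar :=
  ⟨(E.saturation i).starProjection.toLinearMap, fun k => by
    refine ⟨fun x hx => ?_, ⟨1, fun x _ => ?_⟩, fun x hx => ?_⟩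
    · rw [← E.mem_level, ← Submodule.starProjection_eq_self_iff]
      rw [← E.mem_level, ← Submodule.starProjection_eq_self_iff] at hx
      change (E.level k).starProjection ((E.saturation i).starProjection x) = _
      rw [← starProjection_saturation_level_comm, hx]
      rfl
    · rw [one_mul]
      exact Submodule.norm_starProjection_apply_le _ _
    · rw [← E.mem_level_orthogonal, ← Submodule.starProjection_apply_eq_zero_iff] at hx ⊢
      change (E.level k).starProjection ((E.saturation i).starProjection x) = _
      rw [← starProjection_saturation_level_comm, hx, map_zero]⟩

theorem centralSupport_commute (i : Υ) (T : E.cstar) : Commute (E.centralSupport i) T :=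
  Subtype.ext <| LinearMap.ext fun x => E.starProjection_saturation_comm i T x

theorem isStarProjection_centralSupport (i : Υ) : IsStarProjection (E.centralSupport i) where
  isIdempotentElem := Subtype.ext <| LinearMap.ext fun x =>
    Submodule.starProjection_eq_self_iff.2
      (Submodule.starProjection_apply_mem (E.saturation i) x)
  isSelfAdjoint := (E.eq_star_of_inner (S := E.centralSupport i) (T := E.centralSupport i) fun x y =>
    (Submodule.inner_starProjection_left_eq_right (E.saturation i) x y).symm).symm

theorem norm_apply_centralSupport_le (i : Υ) (T : E.cstar) (x : E.domain) :
    ‖T.1 ((E.centralSupport i).1 x)‖ ≤ E.seminorm i T * ‖x‖ :=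
  (E.norm_apply_le_of_mem_saturation (Submodule.starProjection_apply_mem _ x) T).trans <| by
    gcongr
    exact Submodule.norm_starProjection_apply_le _ _

theorem centralSupport_apply_of_mem {i : Υ} {x : E.domain} (hx : (x : H) ∈ E.subspace i) :
    (E.centralSupport i).1 x = x :=
  Submodule.starProjection_eq_self_iff.2 (E.level_le_saturation i hx)

end Adjoint

end QuantizedDomain

/-! ### Matrix seminorms, central projections and purity. -/

theorem matrixSeminorm_zero {A : Type*} [NonUnitalRing A] [StarRing A] [Module ℂ A]
    (p : Seminorm ℂ A) {n : ℕ} : matrixSeminorm p (0 : Matrix (Fin n) (Fin n) A) = 0 := by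
  have : {r : ℝ | ∃ x : Fin n → A, p (star x ⬝ᵥ x) ≤ 1 ∧
      r = √(p (star ((0 : Matrix (Fin n) (Fin n) A).mulVec x) ⬝ᵥ
        (0 : Matrix (Fin n) (Fin n) A).mulVec x))} = {0} := by
    ext r
    constructor
    · rintro ⟨x, -, rfl⟩
      simp
    · rintro rfl
      exact ⟨0, by simp⟩
  rw [matrixSeminorm, this, csSup_singleton]

theorem isMatrixLocalPositive_star_mul_self {A : Type*} [NonUnitalRing A] [StarRing A]
    [Module ℂ A] (p : Seminorm ℂ A) {n : ℕ} (b : Matrix (Fin n) (Fin n) A) :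
    IsMatrixLocalPositive p (star b * b) :=
  ⟨b, 0, (add_zero _).symm, matrixSeminorm_zero p⟩

/-- The complement `w = 1 - z` lets `φ - zφ` be treated as `wφ`, by the same lemma as `zφ`. -/
theorem IsStarProjection.exists_central_compl {R : Type*} [Ring R] [StarRing R] {z : R}
    (hz : IsStarProjection z) (hzc : ∀ t, Commute z t) :
    ∃ w : R, IsStarProjection w ∧ (∀ t, Commute w t) ∧ ∀ t, t - z * t = w * t :=
  ⟨1 - z, hz.one_sub, fun t => (Commute.one_left t).sub_left (hzc t), fun t => by
    rw [sub_mul, one_mul]⟩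

namespace QuantizedDomain

variable {Υ H : Type*} [NormedAddCommGroup H] [InnerProductSpace ℂ H] [CompleteSpace H]
  (E : QuantizedDomain Υ H)

theorem inner_star_dotProduct {n : ℕ} (x : Fin n → E.cstar) (v : E.domain) :
    ⟪v, (star x ⬝ᵥ x : E.cstar).1 v⟫_ℂ = ((∑ j, ‖(x j).1 v‖ ^ 2 : ℝ) : ℂ) := by
  have h : (star x ⬝ᵥ x : E.cstar).1 v = ∑ j, (star (x j)).1 ((x j).1 v) := by
    rw [dotProduct, AddSubmonoidClass.coe_finsetSum, LinearMap.sum_apply]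
    rfl
  rw [h, inner_sum, Complex.ofReal_sum]
  refine Finset.sum_congr rfl fun j _ => ?_
  refine (E.inner_star_right (x j) v ((x j).1 v)).trans ?_
  rw [inner_self_eq_norm_sq_to_K]
  simp

/-- On vectors, `⟪v, (∑ x_k⋆ x_k) v⟫ = ∑ ‖x_k v‖²` dominates each single term. -/
theorem seminorm_sq_le_star_dotProduct (i : Υ) {n : ℕ} (x : Fin n → E.cstar) (j : Fin n) :
    E.seminorm i (x j) ^ 2 ≤ E.seminorm i (star x ⬝ᵥ x) := by
  have h0 : 0 ≤ E.seminorm i (star x ⬝ᵥ x) := apply_nonneg _ _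
  rw [← Real.le_sqrt (apply_nonneg _ _) h0]
  refine E.seminorm_le i _ (Real.sqrt_nonneg _) fun v hv => ?_
  refine (pow_le_pow_iff_left₀ (norm_nonneg _) (by positivity) two_ne_zero).1 ?_
  rw [mul_pow, Real.sq_sqrt h0]
  calc ‖(x j).1 v‖ ^ 2 ≤ ∑ k, ‖(x k).1 v‖ ^ 2 :=
        Finset.single_le_sum (f := fun k => ‖(x k).1 v‖ ^ 2) (fun _ _ => sq_nonneg _)
          (Finset.mem_univ j)
    _ = ‖⟪v, (star x ⬝ᵥ x : E.cstar).1 v⟫_ℂ‖ := by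
        rw [inner_star_dotProduct, Complex.norm_of_nonneg (by positivity)]
    _ ≤ ‖v‖ * ‖(star x ⬝ᵥ x : E.cstar).1 v‖ := norm_inner_le_norm _ _
    _ ≤ ‖v‖ * (E.seminorm i (star x ⬝ᵥ x) * ‖v‖) := by
        gcongr
        exact E.norm_apply_le i _ v hv
    _ = _ := by ring

theorem seminorm_star_dotProduct_le (i : Υ) {n : ℕ} (x : Fin n → E.cstar) :
    E.seminorm i (star x ⬝ᵥ x) ≤ ∑ j, E.seminorm i (x j) ^ 2 := by
  refine (Finset.le_sum_of_subadditive (E.seminorm i) (map_zero (E.seminorm i)).le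
    (map_add_le_add _) _ _).trans ?_
  gcongr with j _
  exact (E.seminorm_mul_le i _ _).trans_eq (by rw [Pi.star_apply, seminorm_star, sq])

/-- The real `sSup` of an unbounded set is `0`, so boundedness is needed before a test vector can
bound `matrixSeminorm` from below. -/
theorem bddAbove_matrixSeminorm (i : Υ) {n : ℕ} (a : Matrix (Fin n) (Fin n) E.cstar) :
    BddAbove {r : ℝ | ∃ x : Fin n → E.cstar, E.seminorm i (star x ⬝ᵥ x) ≤ 1 ∧
      r = √(E.seminorm i (star (a.mulVec x) ⬝ᵥ a.mulVec x))} := by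
  refine ⟨√(∑ j, (∑ k, E.seminorm i (a j k)) ^ 2), ?_⟩
  rintro _ ⟨x, hx, rfl⟩
  refine Real.sqrt_le_sqrt ((E.seminorm_star_dotProduct_le i _).trans ?_)
  gcongr with j _
  refine (Finset.le_sum_of_subadditive (E.seminorm i) (map_zero (E.seminorm i)).le
    (map_add_le_add _) _ _).trans ?_
  gcongr with k _
  have hk : E.seminorm i (x k) ≤ 1 :=
    (sq_le_one_iff₀ (apply_nonneg _ _)).1 ((E.seminorm_sq_le_star_dotProduct i x k).trans hx)
  exact (E.seminorm_mul_le i _ _).trans (mul_le_of_le_one_right (apply_nonneg _ _) hk)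

/-- Multiplication by a central projection does not increase the matrix seminorms. -/
theorem matrixSeminorm_map_mul_le (i : Υ) {z : E.cstar} (hz : IsStarProjection z)
    (hzc : ∀ T : E.cstar, Commute z T) {n : ℕ} (a : Matrix (Fin n) (Fin n) E.cstar) :
    matrixSeminorm (E.seminorm i) (a.map fun T => z * T) ≤ matrixSeminorm (E.seminorm i) a := by
  -- From `z⋆z = z` one gets `‖z x‖² ≤ ‖z x‖ ‖x‖`.
  have hz1 : E.seminorm i z ≤ 1 := by
    refine E.seminorm_le i z zero_le_one fun x _ => ?_
    have h := E.norm_apply_sq_le z x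
    rw [hz.isSelfAdjoint.star_eq, hz.isIdempotentElem.eq] at h
    by_contra! h'
    nlinarith [norm_nonneg x]
  refine csSup_le ⟨_, 0, by simp, rfl⟩ ?_
  rintro _ ⟨x, hx, rfl⟩
  refine le_trans (Real.sqrt_le_sqrt ?_) (le_csSup (E.bddAbove_matrixSeminorm i a) ⟨x, hx, rfl⟩)
  have h1 : (a.map fun T => z * T).mulVec x = fun j => z * a.mulVec x j := by
    ext1 j
    simp only [Matrix.mulVec, dotProduct, Matrix.map_apply, Finset.mul_sum, mul_assoc]
  have h2 : ∀ y : Fin n → E.cstar,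
      star (fun j => z * y j) ⬝ᵥ (fun j => z * y j) = z * (star y ⬝ᵥ y) := by
    intro y
    simp only [dotProduct, Pi.star_apply, Finset.mul_sum, star_mul, hz.isSelfAdjoint.star_eq]
    refine Finset.sum_congr rfl fun j _ => ?_
    rw [mul_assoc, ← mul_assoc z z, hz.isIdempotentElem.eq, ← mul_assoc, ← mul_assoc,
      (hzc (star (y j))).eq]
  rw [h1, h2]
  exact (E.seminorm_mul_le i _ _).trans (mul_le_of_le_one_left (apply_nonneg _ _) hz1)

theorem IsMatrixLocalZero.map_mul {i : Υ} {z : E.cstar} (hz : IsStarProjection z)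
    (hzc : ∀ T : E.cstar, Commute z T) {n : ℕ} {a : Matrix (Fin n) (Fin n) E.cstar}
    (ha : IsMatrixLocalZero (E.seminorm i) a) :
    IsMatrixLocalZero (E.seminorm i) (a.map fun T => z * T) :=
  le_antisymm ((E.matrixSeminorm_map_mul_le i hz hzc a).trans_eq ha)
    (Real.sSup_nonneg (by rintro _ ⟨x, -, rfl⟩; exact Real.sqrt_nonneg _))

theorem IsMatrixLocalPositive.map_mul {i : Υ} {z : E.cstar} (hz : IsStarProjection z)
    (hzc : ∀ T : E.cstar, Commute z T) {n : ℕ} {a : Matrix (Fin n) (Fin n) E.cstar}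
    (ha : IsMatrixLocalPositive (E.seminorm i) a) :
    IsMatrixLocalPositive (E.seminorm i) (a.map fun T => z * T) := by
  obtain ⟨b, c, rfl, hc⟩ := ha
  refine ⟨b.map fun T => z * T, c.map fun T => z * T, ?_, IsMatrixLocalZero.map_mul E hz hzc hc⟩
  ext1 j k
  simp only [Matrix.map_apply, Matrix.add_apply, Matrix.mul_apply, Matrix.star_apply, mul_add,
    Finset.mul_sum, star_mul, hz.isSelfAdjoint.star_eq]
  congr 1
  refine Finset.sum_congr rfl fun l _ => ?_
  rw [mul_assoc, ← mul_assoc z z, hz.isIdempotentElem.eq, ← mul_assoc, ← mul_assoc,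
    (hzc (star (b l j))).eq]

theorem IsLocalCPCC.mulLeft_comp {A Λ : Type*} [NonUnitalRing A] [StarRing A] [Module ℂ A]
    {p : Λ → Seminorm ℂ A} {φ : A →ₗ[ℂ] E.cstar}
    (hφ : IsLocalCPCC (B := E.cstar) p E.seminorm φ) {z : E.cstar} (hz : IsStarProjection z)
    (hzc : ∀ T : E.cstar, Commute z T) :
    IsLocalCPCC (B := E.cstar) p E.seminorm (LinearMap.mulLeft ℂ z ∘ₗ φ) := by
  constructor
  · intro i
    obtain ⟨l, hl⟩ := hφ.1 i
    refine ⟨l, fun n a => ⟨fun ha => ?_, fun ha => ?_⟩⟩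
    · exact IsMatrixLocalPositive.map_mul E hz hzc ((hl n a).1 ha)
    · exact IsMatrixLocalZero.map_mul E hz hzc ((hl n a).2 ha)
  · intro i
    obtain ⟨l, hl⟩ := hφ.2 i
    exact ⟨l, fun n a => (E.matrixSeminorm_map_mul_le i hz hzc _).trans (hl n a)⟩

/-- A matrix that vanishes locally at `ι` has entries that vanish on `H_ι`. -/
theorem IsMatrixLocalZero.apply_eq_zero {i : Υ} {n : ℕ} {c : Matrix (Fin n) (Fin n) E.cstar}
    (hc : IsMatrixLocalZero (E.seminorm i) c) (j k : Fin n) {x : E.domain}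
    (hx : (x : H) ∈ E.subspace i) : (c j k).1 x = 0 := by
  -- Testing on the `k`-th unit vector isolates the `k`-th column of `c`.
  have h1 : star (Pi.single k (1 : E.cstar)) ⬝ᵥ Pi.single k (1 : E.cstar) = 1 := by
    simp
  have h2 := le_csSup (E.bddAbove_matrixSeminorm i c)
    ⟨Pi.single k 1, by rw [h1]; exact E.seminorm_one_le i, rfl⟩
  have h3 : √(E.seminorm i (star (c.mulVec (Pi.single k 1)) ⬝ᵥ c.mulVec (Pi.single k 1))) ≤ 0 :=
    h2.trans_eq hc
  rw [Real.sqrt_le_left le_rfl] at h3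
  have h4 := (E.seminorm_sq_le_star_dotProduct i (c.mulVec (Pi.single k 1)) j).trans h3
  have h5 : c.mulVec (Pi.single k 1) j = c j k := by simp
  rw [h5] at h4
  have h6 : E.seminorm i (c j k) = 0 := by
    apply pow_eq_zero_iff two_ne_zero |>.1
    exact le_antisymm (by simpa using h4) (sq_nonneg _)
  have h7 := E.norm_apply_le i (c j k) x hx
  rw [h6, zero_mul] at h7
  exact norm_le_zero_iff.1 h7

/-- A pure map in `CPCC_loc` is supported on one of the central supports. -/
theorem exists_centralSupport_mul_eq {A Λ : Type*} [NonUnitalRing A] [StarRing A] [Module ℂ A]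
    {p : Λ → Seminorm ℂ A} {φ : A →ₗ[ℂ] E.cstar}
    (hφ : IsLocalCPCC (B := E.cstar) p E.seminorm φ)
    (hpure : IsPureCPCC (B := E.cstar) p E.seminorm φ) :
    ∃ i, ∀ a, E.centralSupport i * φ a = φ a := by
  by_cases h0 : φ = 0
  · exact E.nonempty.elim fun i => ⟨i, fun a => by simp [h0]⟩
  obtain ⟨a, ha⟩ : ∃ a, φ a ≠ 0 := by
    by_contra! h
    exact h0 (LinearMap.ext h)
  obtain ⟨x, hx⟩ : ∃ x, (φ a).1 x ≠ 0 := by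
    by_contra! h
    exact ha (Subtype.ext (LinearMap.ext h))
  obtain ⟨i, hi⟩ := E.mem_domain.1 x.2
  refine ⟨i, ?_⟩
  let z := E.centralSupport i
  have hz := E.isStarProjection_centralSupport i
  have hzc := E.centralSupport_commute i
  obtain ⟨w, hw, hwc, hwmul⟩ := IsStarProjection.exists_central_compl (R := E.cstar) hz hzc
  obtain ⟨α, -, hα⟩ := hpure (LinearMap.mulLeft ℂ z ∘ₗ φ)
    (IsLocalCPCC.mulLeft_comp E hφ hz hzc) (by
      refine (congrArg (IsLocalCPCC (B := E.cstar) p E.seminorm) (LinearMap.ext fun b => ?_)).mpr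
        (IsLocalCPCC.mulLeft_comp E hφ hw hwc)
      exact hwmul (φ b))
  have hmul : ∀ b, z * φ b = (α : ℂ) • φ b := fun b => LinearMap.congr_fun hα b
  -- Both `z φ(a) x = φ(a) z x = φ(a) x` and `z φ(a) x = α φ(a) x` hold, with `φ(a) x ≠ 0`.
  have hfix : (φ a).1 x = (α : ℂ) • (φ a).1 x := by
    have h1 : (z * φ a).1 x = (φ a).1 x := by
      rw [(hzc (φ a)).eq]
      exact congrArg (φ a).1 (E.centralSupport_apply_of_mem hi)
    rw [hmul a] at h1
    exact h1.symm
  have hα1 : (α : ℂ) = 1 := by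
    have h : ((1 : ℂ) - α) • (φ a).1 x = 0 := by
      rw [sub_smul, one_smul, ← hfix, sub_self]
    exact (sub_eq_zero.1 ((smul_eq_zero.1 h).resolve_right hx)).symm
  intro b
  rw [hmul, hα1, one_smul]

end QuantizedDomain

/-! ### Positive matrices over `B(H)`. -/

section PositiveOperatorMatrix

open scoped ComplexOrder
open ContinuousLinearMap

variable {H : Type*} [NormedAddCommGroup H] [InnerProductSpace ℂ H] [CompleteSpace H]

theorem PiLp.adjoint_proj_apply {n : ℕ} (k : Fin n) (u : H) :
    adjoint (PiLp.proj 2 (fun _ : Fin n => H) k : PiLp 2 (fun _ : Fin n => H) →L[ℂ] H) u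
      = WithLp.toLp 2 (Pi.single k u) := by
  refine ext_inner_right ℂ fun y => ?_
  rw [adjoint_inner_left, PiLp.inner_apply, Finset.sum_eq_single k]
  · simp
  · intro j _ hj
    simp [hj]
  · simp

/-- The statement `isPositiveElement_of_inner_nonneg`, in terms of a Hilbert space `K` that is
the direct sum of `n` copies of `H` with coordinate maps `pr`. -/
theorem isPositiveElement_of_inner_nonneg_of_proj {K : Type*} [NormedAddCommGroup K]
    [InnerProductSpace ℂ K] [CompleteSpace K] {n : ℕ} (pr : Fin n → K →L[ℂ] H)
    (hone : ∑ j, adjoint (pr j) ∘L pr j = 1)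
    (hpr : ∀ j k (u : H), pr j (adjoint (pr k) u) = if j = k then u else 0)
    (m : Matrix (Fin n) (Fin n) (H →L[ℂ] H))
    (hm : ∀ x : Fin n → H, 0 ≤ ∑ j, ∑ k, ⟪x j, m j k (x k)⟫_ℂ) : IsPositiveElement m := by
  -- `M` is the operator on the direct sum with block matrix `m`; the blocks of `D` in `M = D⋆D`
  -- will form the required `d`.
  let M : K →L[ℂ] K := ∑ j, ∑ k, adjoint (pr j) ∘L m j k ∘L pr k
  have hMinner : ∀ x : K, ⟪x, M x⟫_ℂ = ∑ j, ∑ k, ⟪pr j x, m j k (pr k x)⟫_ℂ := by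
    intro x
    simp only [M, sum_apply, inner_sum, coe_comp, Function.comp_apply, adjoint_inner_right]
  have hMpos : 0 ≤ M := by
    rw [nonneg_iff_isPositive, isPositive_iff_complex]
    intro x
    have h := hm fun j => pr j x
    rw [← hMinner, ← inner_conj_symm, Complex.nonneg_iff] at h
    simp only [Complex.conj_re, Complex.conj_im] at h
    exact ⟨Complex.ext rfl (by simpa [eq_comm] using h.2), h.1⟩
  obtain ⟨D, hD⟩ := CStarAlgebra.nonneg_iff_eq_star_mul_self.1 hMpos
  refine ⟨Matrix.of fun j k => pr j ∘L D ∘L adjoint (pr k), ?_⟩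
  ext1 j k
  have h1 : m j k = pr j ∘L M ∘L adjoint (pr k) := by
    ext1 u
    simp only [M, coe_comp, Function.comp_apply, sum_apply, map_sum, hpr]
    simp [apply_ite]
  rw [h1, hD, Matrix.mul_apply]
  -- Inserting the resolution of the identity between `D⋆` and `D` produces the sum over `l` in the
  -- matrix product.
  have h2 : star D * D = ∑ l, star D ∘L (adjoint (pr l) ∘L pr l) ∘L D := by
    rw [← comp_finsetSum, ← finsetSum_comp, hone]
    rfl
  rw [h2, finsetSum_comp, comp_finsetSum]
  refine Finset.sum_congr rfl fun l _ => ?_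
  simp only [Matrix.star_apply, Matrix.of_apply, star_eq_adjoint, adjoint_comp, adjoint_adjoint]
  rfl

/-- A matrix of bounded operators whose quadratic form is nonnegative is of the form `d⋆ d`. -/
theorem isPositiveElement_of_inner_nonneg {n : ℕ} (m : Matrix (Fin n) (Fin n) (H →L[ℂ] H))
    (hm : ∀ x : Fin n → H, 0 ≤ ∑ j, ∑ k, ⟪x j, m j k (x k)⟫_ℂ) : IsPositiveElement m := by
  refine isPositiveElement_of_inner_nonneg_of_proj
    (fun j => (PiLp.proj 2 (fun _ : Fin n => H) j : PiLp 2 (fun _ : Fin n => H) →L[ℂ] H))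
    ?_ ?_ m hm
  · refine ContinuousLinearMap.ext fun x => ext_inner_right ℂ fun y => ?_
    simp only [sum_apply, sum_inner, coe_comp, Function.comp_apply, adjoint_inner_left]
    exact (PiLp.inner_apply x y).symm
  · intro j k u
    rw [PiLp.adjoint_proj_apply]
    simp

end PositiveOperatorMatrix

/-! ### Extension to `B(H)` and complete positivity. -/

namespace QuantizedDomain

open scoped ComplexOrder

variable {Υ H : Type*} [NormedAddCommGroup H] [InnerProductSpace ℂ H] (E : QuantizedDomain Υ H)

theorem dense_domain : Dense (E.domain : Set H) :=
  E.dense.mono fun _ hx => E.mem_domain.2 (Set.mem_iUnion.1 hx)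

variable [CompleteSpace H]

/-- A linear map into `C⋆(D_E)` whose values are bounded on `D_E` extends to `B(H)`. -/
theorem exists_extension {A : Type*} [AddCommGroup A] [Module ℂ A] (φ : A →ₗ[ℂ] E.cstar)
    (h : ∀ a, ∃ C : ℝ, ∀ x, ‖(φ a).1 x‖ ≤ C * ‖x‖) :
    ∃ Φ : A →ₗ[ℂ] (H →L[ℂ] H), ∀ (a : A) (x : E.domain), Φ a x = ((φ a).1 x : H) := by
  have hd : DenseRange E.domain.subtype := by
    simpa [DenseRange] using E.dense_domain
  have key : ∀ a, ∃ F : H →L[ℂ] H, ∀ x : E.domain, F x = ((φ a).1 x : H) := fun a =>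
    ⟨(E.domain.subtype ∘ₗ (φ a).1).extendOfNorm E.domain.subtype,
      fun x => LinearMap.extendOfNorm_eq (f := E.domain.subtype ∘ₗ (φ a).1) hd (h a) x⟩
  choose F hF using key
  have huniq : ∀ S T : H →L[ℂ] H, (∀ x : E.domain, S x = T x) → S = T := fun S T hST =>
    ContinuousLinearMap.coeFn_injective <|
      S.continuous.ext_on E.dense_domain T.continuous fun x hx => hST ⟨x, hx⟩
  exact ⟨{
    toFun := F
    map_add' := fun a b => huniq _ _ fun x => by
      simp [hF, map_add]
    map_smul' := fun c a => huniq _ _ fun x => by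
      simp [hF, map_smul] }, hF⟩

/-- On vectors of `H_ι` the error term `c` vanishes, and `e⋆e` contributes the sum of squares `∑_l
‖∑_j e_{lj} x_j‖²`. -/
theorem inner_sum_nonneg_of_isMatrixLocalPositive {i : Υ} {n : ℕ}
    {a : Matrix (Fin n) (Fin n) E.cstar} (ha : IsMatrixLocalPositive (E.seminorm i) a)
    {x : Fin n → E.domain} (hx : ∀ j, (x j : H) ∈ E.subspace i) :
    0 ≤ ∑ j, ∑ k, ⟪x j, (a j k).1 (x k)⟫_ℂ := by
  obtain ⟨e, c, rfl, hc⟩ := ha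
  have h1 : ∀ j k, ⟪x j, ((star e * e + c) j k).1 (x k)⟫_ℂ
      = ∑ l, ⟪(e l j).1 (x j), (e l k).1 (x k)⟫_ℂ := by
    intro j k
    have : ((star e * e + c) j k).1 (x k)
        = ∑ l, (star (e l j)).1 ((e l k).1 (x k)) + (c j k).1 (x k) := by
      rw [Matrix.add_apply, Matrix.mul_apply, Subalgebra.coe_add, LinearMap.add_apply,
        AddSubmonoidClass.coe_finsetSum, LinearMap.sum_apply]
      rfl
    rw [this, IsMatrixLocalZero.apply_eq_zero E hc j k (hx k), add_zero, inner_sum]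
    exact Finset.sum_congr rfl fun l _ => E.inner_star_right (e l j) (x j) ((e l k).1 (x k))
  have h2 : ∑ j, ∑ k, ⟪x j, ((star e * e + c) j k).1 (x k)⟫_ℂ
      = ∑ l, ⟪∑ j, (e l j).1 (x j), ∑ k, (e l k).1 (x k)⟫_ℂ := by
    simp only [h1]
    rw [Finset.sum_congr rfl fun j _ => Finset.sum_comm, Finset.sum_comm]
    refine Finset.sum_congr rfl fun l _ => ?_
    rw [sum_inner]
    exact Finset.sum_congr rfl fun j _ => (inner_sum _ _ _).symm
  rw [h2]
  exact Finset.sum_nonneg fun l _ => by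
    rw [inner_self_eq_norm_sq_to_K]
    exact_mod_cast RCLike.ofReal_nonneg (K := ℂ).2 (sq_nonneg (‖∑ j, (e l j).1 (x j)‖))

/-- An extension to `B(H)` of a local completely positive map is completely positive. -/
theorem IsLocalCP.isCompletelyPositive {A Λ : Type*} [NonUnitalRing A] [StarRing A]
    [Module ℂ A] {p : Λ → Seminorm ℂ A} {φ : A →ₗ[ℂ] E.cstar}
    (hφ : IsLocalCP (B := E.cstar) p E.seminorm φ) {Φ : A →ₗ[ℂ] (H →L[ℂ] H)}
    (hΦ : ∀ (a : A) (x : E.domain), Φ a x = ((φ a).1 x : H)) : IsCompletelyPositive Φ := by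
  rintro n _ ⟨b, rfl⟩
  refine isPositiveElement_of_inner_nonneg _ fun x => ?_
  -- Nonnegativity of the form is a closed condition on the tuple, so tuples from the dense domain
  -- suffice.
  have hclosed : IsClosed {x : Fin n → H |
      0 ≤ ∑ j, ∑ k, ⟪x j, (star b * b).map Φ j k (x k)⟫_ℂ} :=
    isClosed_le continuous_const (by fun_prop)
  have hdense : Dense (Set.univ.pi fun _ : Fin n => (E.domain : Set H)) :=
    dense_pi _ fun _ _ => E.dense_domain
  refine hclosed.closure_subset_iff.2 ?_ (hdense x)
  intro y hy
  have hy' : ∀ j, ∃ i, y j ∈ E.subspace i := fun j => E.mem_domain.1 (hy j trivial)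
  choose f hf using hy'
  have := E.nonempty
  -- Local positivity is available at one index at a time, so all coordinates are moved into a
  -- common `H_ι`.
  obtain ⟨i, hi⟩ := E.directed.finite_le f
  obtain ⟨l, hl⟩ := hφ i
  have := E.inner_sum_nonneg_of_isMatrixLocalPositive
    ((hl n _).1 (isMatrixLocalPositive_star_mul_self (p l) b))
    (x := fun j => ⟨y j, hy j trivial⟩) (fun j => hi j (hf j))
  refine this.trans_eq (Finset.sum_congr rfl fun j _ => Finset.sum_congr rfl fun k _ => ?_)
  exact congrArg (fun v => ⟪y j, v⟫_ℂ) (hΦ _ ⟨y k, hy k trivial⟩).symm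

end QuantizedDomain

theorem mainTheorem7 {A Λ Υ H : Type*} [NonUnitalRing A] [StarRing A] [Module ℂ A]
    [IsScalarTower ℂ A A] [SMulCommClass ℂ A A] [StarModule ℂ A] [UniformSpace A]
    [IsUniformAddGroup A] [CompleteSpace A] [T2Space A]
    (p : Λ → Seminorm ℂ A) (hA : IsLocallyCStarAlgebra p)
    [NormedAddCommGroup H] [InnerProductSpace ℂ H] [CompleteSpace H]
    (E : QuantizedDomain Υ H) (φ : A →ₗ[ℂ] E.cstar)
    (hφ : IsLocalCPCC (B := E.cstar) p E.seminorm φ) (hpure : IsPureCPCC (B := E.cstar) p E.seminorm φ) :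
    (∀ a : A, IsBoundedElement E.seminorm (φ a)) ∧
    ∃ Φ : A →ₗ[ℂ] (H →L[ℂ] H),
      (∀ (a : A) (x : E.domain), Φ a x = ((φ a).1 x : H)) ∧ IsCompletelyPositive Φ := by
  obtain ⟨i, hi⟩ := E.exists_centralSupport_mul_eq hφ hpure
  have hbound : ∀ a x, ‖(φ a).1 x‖ ≤ E.seminorm i (φ a) * ‖x‖ := by
    intro a x
    -- Centrality moves `z` to the right of `φ(a)`, where it sends `x` into the saturation.
    have h : (φ a).1 x = (φ a).1 ((E.centralSupport i).1 x) := by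
      have := (E.centralSupport_commute i (φ a)).eq
      rw [hi] at this
      exact LinearMap.congr_fun (congrArg Subtype.val this) x
    rw [h]
    exact E.norm_apply_centralSupport_le i (φ a) x
  refine ⟨fun a => ⟨E.seminorm i (φ a), ?_⟩, ?_⟩
  · rintro _ ⟨k, rfl⟩
    exact E.seminorm_le k _ (apply_nonneg _ _) fun x _ => hbound a x
  · obtain ⟨Φ, hΦ⟩ := E.exists_extension φ fun a => ⟨_, hbound a⟩
    exact ⟨Φ, hΦ, QuantizedDomain.IsLocalCP.isCompletelyPositive E hφ.1 hΦ⟩
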